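/- Let $(\mathcal C,w)$ be a triangulated category with a weight structure $w=(\mathcal C_{w\le 0},\mathcal C_{w\ge 0})$ in the homological convention: both classes are closed under retracts in $\mathcal C$, $\mathcal C_{w\le 0}\subset \mathcal C_{w\le 0}[1]$, $\mathcal C_{w\ge 0}[1]\subset\mathcal C_{w\ge 0}$, $\mathcal C(X,Y[1])=0$ for $X\in\mathcal C_{w\le 0}$, $Y\in\mathcal C_{w\ge 0}$, and every object $M$ sits in a distinguished triangle $X\to M\to Y[1]\to X[1]$ with $X\in\mathcal C_{w\le 0}$, $Y\in\mathcal C_{w\ge 0}$. Assume that $w$ is bounded below, i.e. $\operatorname{Obj}\mathcal C=\bigcup_{n\in\mathbb Z}\mathcal C_{w\ge 0}[n]$. Let $\underline{Hw}$ be the heart of $w$, the full subcategory of $\mathcal C$ on $\mathcal C_{w\le 0}\cap\mathcal C_{w\ge 0}$, and let $S$ be a class of morphisms of $\underline{Hw}$ satisfying the left Ore condition: for all morphisms $s:d\to c$ in $S$ and $f:d\to b$ in $\underline{Hw}$ there exist an object $a$ and morphisms $g:b\to a$ in $S$ and $u:c\to a$ in $\underline{Hw}$ with $g\circ f=u\circ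 s$. Let $\mathcal D$ be the smallest strictly full triangulated subcategory of $\mathcal C$ containing all cones of elements of $S$, and let $L:\mathcal C\to\mathcal C/\mathcal D$ be the Verdier localization. Call an exact functor between triangulated categories with weight structures weight-exact if it maps objects of non-positive (resp. non-negative) weights to objects of non-positive (resp. non-negative) weights. Then there is exactly one weight structure $w_{\mathcal C/\mathcal D}$ on $\mathcal C/\mathcal D$ for which $L$ is weight-exact, and $L$ has the strong left weight lifting property with respect to $w$ and $w_{\mathcal C/\mathcal D}$: for every object $X$ of $\mathcal C$ with $L(X)\in(\mathcal C/\mathcal D)_{w_{\mathcal C/\mathcal D}\ge 0}$ there is a distinguished triangle $T\to X\to X'\to T[1]$ in $\mathcal C$ with $L(T)=0$ and $X'\in\mathcal C_{w\ge 0}$; moreover, the triangle can be chosen with $T\in\operatorname{Obj}\mathcal D\cap\mathcal C_{w\le 0}$. -/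

import Mathlib

open CategoryTheory CategoryTheory.Limits CategoryTheory.Pretriangulated

universe v₁ v₂ u₁ u₂

namespace WeightLifting

section General

variable {A : Type u₁} [Category.{v₁} A]

/-- The left Ore condition (without any cancellation property) for a class `S` of morphisms:
every span `b ⟵f d s⟶ c` with `s ∈ S` can be completed to a commutative square
`f ≫ g = s ≫ u` with `g : b ⟶ a` in `S`. -/
def LeftOre (S : MorphismProperty A) : Prop :=
  ∀ ⦃b c d : A⦄ (s : d ⟶ c) (f : d ⟶ b), S s →
    ∃ (a : A) (g : b ⟶ a) (u : c ⟶ a), S g ∧ f ≫ g = s ≫ u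

end General

section Triangulated

variable {C : Type u₁} [Category.{v₁} C] [HasZeroObject C] [HasShift C ℤ] [Preadditive C]
  [∀ n : ℤ, (shiftFunctor C n).Additive] [Pretriangulated C]

/-- The smallest strictly full triangulated subcategory containing the class of objects `B`
(it is not required to be closed under retracts). -/
def triangulatedClosure (B : ObjectProperty C) : ObjectProperty C :=
  fun X => ∀ P : ObjectProperty C, P.IsTriangulated → P.IsClosedUnderIsomorphisms → B ≤ P → P X

variable (C) in
/-- A weight structure (in the homological convention): `nonpos` is the class `C_{w ≤ 0}` and
`nonneg` is the class `C_{w ≥ 0}`. -/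
@[ext]
structure WeightStructure where
  nonpos : ObjectProperty C
  nonneg : ObjectProperty C
  nonpos_retracts : nonpos.IsStableUnderRetracts
  nonneg_retracts : nonneg.IsStableUnderRetracts
  /-- `C_{w ≤ 0} ⊆ C_{w ≤ 0}[1]` -/
  nonpos_shift : ∀ X : C, nonpos X → nonpos (X⟦(-1 : ℤ)⟧)
  /-- `C_{w ≥ 0}[1] ⊆ C_{w ≥ 0}` -/
  nonneg_shift : ∀ X : C, nonneg X → nonneg (X⟦(1 : ℤ)⟧)
  orthogonality : ∀ X Y : C, nonpos X → nonneg Y → ∀ f : X ⟶ Y⟦(1 : ℤ)⟧, f = 0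
  decomposition : ∀ M : C, ∃ (X Y : C) (f : X ⟶ M) (g : M ⟶ Y⟦(1 : ℤ)⟧)
    (h : Y⟦(1 : ℤ)⟧ ⟶ X⟦(1 : ℤ)⟧),
      nonpos X ∧ nonneg Y ∧ Triangle.mk f g h ∈ distTriang C

namespace WeightStructure

variable (w : WeightStructure C)

/-- The class `C_{w ≥ n} = C_{w ≥ 0}[n]`. -/
def ge (n : ℤ) : ObjectProperty C := fun X => w.nonneg (X⟦-n⟧)

/-- The weight structure is bounded below: every object lies in `C_{w ≥ n}` for some `n`. -/
def BoundedBelow : Prop := ∀ X : C, ∃ n : ℤ, w.ge n X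

/-- The class `C_{w = 0}` of objects of the heart. -/
def heart : ObjectProperty C := fun X => w.nonpos X ∧ w.nonneg X

/-- The heart, as a full subcategory of `C`. -/
abbrev Heart : Type u₁ := w.heart.FullSubcategory

/-- The class of all cones of elements of a class `S` of morphisms of the heart. -/
def cones (S : MorphismProperty w.Heart) : ObjectProperty C :=
  fun Z => ∃ (X Y : w.Heart) (s : X ⟶ Y) (g : Y.obj ⟶ Z) (h : Z ⟶ X.obj⟦(1 : ℤ)⟧),
    S s ∧ Triangle.mk s.hom g h ∈ distTriang C

end WeightStructure

variable {E : Type u₂} [Category.{v₂} E] [HasZeroObject E] [HasShift E ℤ] [Preadditive E]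
  [∀ n : ℤ, (shiftFunctor E n).Additive] [Pretriangulated E]

/-- The functor `F` preserves non-positive and non-negative weights. -/
structure WeightExact (F : C ⥤ E) (w : WeightStructure C) (w' : WeightStructure E) : Prop where
  nonpos : ∀ X : C, w.nonpos X → w'.nonpos (F.obj X)
  nonneg : ∀ X : C, w.nonneg X → w'.nonneg (F.obj X)

/-- The strong left weight lifting property (for a weight-exact triangulated functor `F`):
every `X` with `F X` of non-negative weights sits in a distinguished triangle
`T ⟶ X ⟶ X' ⟶ T[1]` with `F T = 0` and `X'` of non-negative weights. -/
def StrongLeftWeightLifting (F : C ⥤ E) (w : WeightStructure C) (w' : WeightStructure E) : Prop :=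
  ∀ X : C, w'.nonneg (F.obj X) →
    ∃ (T X' : C) (f : T ⟶ X) (g : X ⟶ X') (h : X' ⟶ T⟦(1 : ℤ)⟧),
      Triangle.mk f g h ∈ distTriang C ∧ IsZero (F.obj T) ∧ w.nonneg X'

end Triangulated

end WeightLifting

namespace WeightLifting

/-! ### Exactness of Hom on distinguished triangles -/

section Exactness

variable {C : Type u₁} [Category.{v₁} C] [HasZeroObject C] [HasShift C ℤ] [Preadditive C]
  [∀ n : ℤ, (shiftFunctor C n).Additive] [Pretriangulated C]
  {X Y Z : C} {f : X ⟶ Y} {g : Y ⟶ Z} {h : Z ⟶ X⟦(1 : ℤ)⟧}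

/-! Everything rests on truncating objects of `D` inside `D`. Each is an extension of an object of
`D` of weights `≥ m` by one of weights `≤ m`, even though `w` need not restrict to `D`. A shifted
cone of an element of `S` already lies on one side, and such extensions are stable under further
extension because the connecting map from the lower to the upper part vanishes
(`cones_le_truncatable`, `triangulatedClosure_le_truncatable`). The Ore condition adds that the
lower part has its maps to weight `m` killed by maps with cone in `D` (`kills`).

Truncation moves the target of a fraction into the right weights, so orthogonality descends to `E`
(`exists_ge_of_trW`, `hom_eq_zero_of_isLocalization`). The retract closures of the images then form
a weight structure, and orthogonality makes it the only one (`eq_of_le`).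

For lifting, if `L.obj X` has nonnegative weights, maps to `X` from negative weights vanish under
`L`, hence factor through `D`. This allows the lowest weight of `X` to be removed by an object of
`D` (`exists_triangle_of_factors`); boundedness below makes finitely many such steps enough. -/

lemma exists_desc (hT : Triangle.mk f g h ∈ distTriang C) {W : C} (k : Y ⟶ W)
    (hk : f ≫ k = 0) : ∃ l : Z ⟶ W, k = g ≫ l :=
  Triangle.yoneda_exact₂ _ hT k hk

lemma exists_lift (hT : Triangle.mk f g h ∈ distTriang C) {W : C} (k : W ⟶ Y)
    (hk : k ≫ g = 0) : ∃ l : W ⟶ X, k = l ≫ f :=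
  Triangle.coyoneda_exact₂ _ hT k hk

lemma exists_lift₃ (hT : Triangle.mk f g h ∈ distTriang C) {W : C} (k : W ⟶ Z)
    (hk : k ≫ h = 0) : ∃ l : W ⟶ Y, k = l ≫ g :=
  Triangle.coyoneda_exact₃ _ hT k hk

lemma exists_desc₃ (hT : Triangle.mk f g h ∈ distTriang C) {W : C} (k : Z ⟶ W)
    (hk : g ≫ k = 0) : ∃ l : X⟦(1 : ℤ)⟧ ⟶ W, k = h ≫ l :=
  Triangle.yoneda_exact₃ _ hT k hk

lemma comp_eq_zero₁₂ (hT : Triangle.mk f g h ∈ distTriang C) : f ≫ g = 0 :=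
  comp_distTriang_mor_zero₁₂ _ hT

lemma comp_eq_zero₃₁ (hT : Triangle.mk f g h ∈ distTriang C) : h ≫ f⟦(1 : ℤ)⟧' = 0 :=
  comp_distTriang_mor_zero₃₁ _ hT

end Exactness

namespace WeightStructure

/-! ### Formal properties of weight structures -/

section Basic

variable {C : Type u₁} [Category.{v₁} C] [HasZeroObject C] [HasShift C ℤ] [Preadditive C]
  [∀ n : ℤ, (shiftFunctor C n).Additive] [Pretriangulated C] (w : WeightStructure C)

/-- The class `C_{w ≤ n} = C_{w ≤ 0}[n]`. -/
def le (n : ℤ) : ObjectProperty C := fun X => w.nonpos (X⟦-n⟧)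

instance : w.nonpos.IsStableUnderRetracts := w.nonpos_retracts

instance : w.nonneg.IsStableUnderRetracts := w.nonneg_retracts

instance (n : ℤ) : (w.le n).IsStableUnderRetracts where
  of_retract r h := w.nonpos.prop_of_retract (r.map (shiftFunctor C (-n))) h

instance (n : ℤ) : (w.ge n).IsStableUnderRetracts where
  of_retract r h := w.nonneg.prop_of_retract (r.map (shiftFunctor C (-n))) h

lemma le_zero_iff (X : C) : w.le 0 X ↔ w.nonpos X :=
  w.nonpos.prop_iff_of_iso ((shiftFunctorZero' C (-0 : ℤ) (by simp)).app X)

lemma ge_zero_iff (X : C) : w.ge 0 X ↔ w.nonneg X :=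
  w.nonneg.prop_iff_of_iso ((shiftFunctorZero' C (-0 : ℤ) (by simp)).app X)

lemma le_shift_iff (X : C) (n k m : ℤ) (h : n + k = m) : w.le m (X⟦k⟧) ↔ w.le n X :=
  w.nonpos.prop_iff_of_iso ((shiftFunctorAdd' C k (-m) (-n) (by lia)).app X).symm

lemma ge_shift_iff (X : C) (n k m : ℤ) (h : n + k = m) : w.ge m (X⟦k⟧) ↔ w.ge n X :=
  w.nonneg.prop_iff_of_iso ((shiftFunctorAdd' C k (-m) (-n) (by lia)).app X).symm

lemma le_monotone {m n : ℤ} (h : m ≤ n) : w.le m ≤ w.le n := by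
  intro X hX
  obtain ⟨k, rfl⟩ := Int.le.dest h
  induction k with
  | zero => simpa using hX
  | succ k ih =>
    have := w.nonpos_shift _ (ih (by lia))
    exact w.nonpos.prop_of_iso ((shiftFunctorAdd' C (-(m + k)) (-1) (-(m + (k + 1 : ℕ)))
      (by push_cast; ring)).app X).symm this

lemma ge_antitone {m n : ℤ} (h : m ≤ n) : w.ge n ≤ w.ge m := by
  intro X hX
  obtain ⟨k, rfl⟩ := Int.le.dest h
  induction k generalizing m with
  | zero => simpa using hX
  | succ k ih =>
    have := w.nonneg_shift _ (ih (m := m + 1) (by lia)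
      (by rwa [show m + 1 + (k : ℤ) = m + (k + 1 : ℕ) by push_cast; ring]))
    exact w.nonneg.prop_of_iso ((shiftFunctorAdd' C (-(m + 1)) 1 (-m)
      (by ring)).app X).symm this

lemma hom_eq_zero {X Y : C} {m n : ℤ} (hX : w.le m X) (hY : w.ge n Y) (h : m < n)
    (f : X ⟶ Y) : f = 0 := by
  have hY' : w.ge (m + 1) Y := w.ge_antitone (by lia) _ hY
  let e := (shiftFunctorAdd' C (-(m + 1)) 1 (-m) (by ring)).app Y
  apply (shiftFunctor C (-m)).map_injective
  rw [← cancel_mono e.hom, Functor.map_zero, zero_comp]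
  exact w.orthogonality _ _ hX hY' _

lemma exists_decomposition (n : ℤ) (M : C) :
    (w.le n).extensionProduct (w.ge (n + 1)) M := by
  obtain ⟨X, Y, f, g, h, hX, hY, hT⟩ := w.decomposition (M⟦-n⟧)
  refine ObjectProperty.prop_of_iso _ ((shiftFunctorCompIsoId C (-n) n (by simp)).app M)
    ⟨_, _, _, _, _, Triangle.shift_distinguished _ hT n, ?_, ?_⟩
  · exact (w.le_shift_iff _ 0 n n (by simp)).2 ((w.le_zero_iff X).2 hX)
  · exact (w.ge_shift_iff _ 1 n (n + 1) (by ring)).2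
      ((w.ge_shift_iff _ 0 1 1 (by simp)).2 ((w.ge_zero_iff Y).2 hY))

/-- In a weight decomposition the map from the `≤ n` part is zero, so `X` is a retract of the `≥ n +
1` part. -/
lemma ge_of_forall_hom_eq_zero {n : ℤ} {X : C}
    (h : ∀ (Z : C) (_ : w.le n Z) (f : Z ⟶ X), f = 0) : w.ge (n + 1) X := by
  obtain ⟨A, B, f, g, k, hT, hA, hB⟩ := w.exists_decomposition n X
  obtain ⟨r, hr⟩ := exists_desc hT (𝟙 X) (by simp [h A hA f])
  exact (w.ge (n + 1)).prop_of_retract ⟨g, r, hr.symm⟩ hB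

lemma le_of_forall_hom_eq_zero {n : ℤ} {X : C}
    (h : ∀ (Z : C) (_ : w.ge (n + 1) Z) (f : X ⟶ Z), f = 0) : w.le n X := by
  obtain ⟨A, B, f, g, k, hT, hA, hB⟩ := w.exists_decomposition n X
  obtain ⟨r, hr⟩ := exists_lift hT (𝟙 X) (by simp [h B hB g])
  exact (w.le n).prop_of_retract ⟨r, f, hr.symm⟩ hA

instance (n : ℤ) : (w.ge n).IsTriangulatedClosed₂ := .mk' (fun T hT h₁ h₃ => by
  obtain ⟨m, rfl⟩ : ∃ m, n = m + 1 := ⟨n - 1, by ring⟩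
  refine w.ge_of_forall_hom_eq_zero (fun Z hZ f => ?_)
  obtain ⟨g, rfl⟩ := Triangle.coyoneda_exact₂ _ hT f (w.hom_eq_zero hZ h₃ (by lia) _)
  rw [w.hom_eq_zero hZ h₁ (by lia) g, zero_comp])

instance (n : ℤ) : (w.le n).IsTriangulatedClosed₂ := .mk' (fun T hT h₁ h₃ => by
  refine w.le_of_forall_hom_eq_zero (fun Z hZ f => ?_)
  obtain ⟨g, rfl⟩ := Triangle.yoneda_exact₂ _ hT f (w.hom_eq_zero h₁ hZ (by lia) _)
  rw [w.hom_eq_zero h₃ hZ (by lia) g, comp_zero])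

lemma le_of_isZero {n : ℤ} {X : C} (hX : IsZero X) : w.le n X :=
  w.le_of_forall_hom_eq_zero (fun _ _ _ => hX.eq_of_src _ _)

lemma ge_of_isZero {n : ℤ} {X : C} (hX : IsZero X) : w.ge n X := by
  obtain ⟨m, rfl⟩ : ∃ m, n = m + 1 := ⟨n - 1, by ring⟩
  exact w.ge_of_forall_hom_eq_zero (fun _ _ _ => hX.eq_of_tgt _ _)

-- Each class is the orthogonal of the other, so enlarging one shrinks the other.
variable {w} in
lemma eq_of_le {w' : WeightStructure C} (h₁ : w.nonpos ≤ w'.nonpos)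
    (h₂ : w.nonneg ≤ w'.nonneg) : w = w' := by
  have hle (n : ℤ) : w.le n ≤ w'.le n := fun _ h => h₁ _ h
  have hge (n : ℤ) : w.ge n ≤ w'.ge n := fun _ h => h₂ _ h
  ext X
  · refine ⟨h₁ X, fun h => ?_⟩
    rw [← le_zero_iff] at h ⊢
    exact w.le_of_forall_hom_eq_zero
      (fun Z hZ f => w'.hom_eq_zero h (hge _ _ hZ) (by lia) f)
  · refine ⟨h₂ X, fun h => ?_⟩
    rw [← ge_zero_iff] at h ⊢
    exact w.ge_of_forall_hom_eq_zero (n := -1)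
      (fun Z hZ f => w'.hom_eq_zero (hle _ _ hZ) h (by lia) f)

end Basic

end WeightStructure

/-! ### The triangulated closure -/

section Closure

variable {C : Type u₁} [Category.{v₁} C] [HasZeroObject C] [HasShift C ℤ] [Preadditive C]
  [∀ n : ℤ, (shiftFunctor C n).Additive] [Pretriangulated C]

instance (B : ObjectProperty C) : (triangulatedClosure B).IsClosedUnderIsomorphisms where
  of_iso e hX P hP hP' hB := P.prop_of_iso e (hX P hP hP' hB)

instance (B : ObjectProperty C) : (triangulatedClosure B).IsTriangulated where
  exists_zero := ⟨_, isZero_zero C, fun P _ _ _ => P.prop_zero⟩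
  isStableUnderShiftBy n := ⟨fun _ hX P hP hP' hB => P.le_shift n _ (hX P hP hP' hB)⟩
  toIsTriangulatedClosed₂ := .mk' (fun T hT h₁ h₃ P hP hP' hB =>
    P.ext_of_isTriangulatedClosed₂ T hT (h₁ P hP hP' hB) (h₃ P hP hP' hB))

lemma le_triangulatedClosure (B : ObjectProperty C) : B ≤ triangulatedClosure B :=
  fun _ hX _ _ _ hB => hB _ hX

end Closure

namespace WeightStructure

/-! ### Truncation inside a triangulated subcategory -/

section Truncation

variable {C : Type u₁} [Category.{v₁} C] [HasZeroObject C] [HasShift C ℤ] [Preadditive C]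
  [∀ n : ℤ, (shiftFunctor C n).Additive] [Pretriangulated C] (w : WeightStructure C)
  (D : ObjectProperty C)

/-- Objects `X` such that every morphism from `X` to an object `b⟦m⟧`, with `b` in the heart,
is killed by a morphism `b ⟶ a` of the heart with cone in `D`. -/
def kills (m : ℤ) : ObjectProperty C := fun X =>
  ∀ (b : C) (_ : w.heart b) (φ : X ⟶ b⟦m⟧),
    ∃ (a : C) (_ : w.heart a) (t : b ⟶ a), D.trW t ∧ φ ≫ t⟦m⟧' = 0

/-- The objects of `D` of weights `≤ m` all of whose morphisms to objects of weight `m` are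
killed by morphisms with cone in `D`. -/
def lower (m : ℤ) : ObjectProperty C := fun X => D X ∧ w.le m X ∧ w.kills D m X

/-- The objects of `D` of weights `≥ m`. -/
def upper (m : ℤ) : ObjectProperty C := D ⊓ w.ge m

instance (m : ℤ) : (w.kills D m).IsClosedUnderIsomorphisms where
  of_iso e hX b hb φ := by
    obtain ⟨a, ha, t, ht, h⟩ := hX b hb (e.hom ≫ φ)
    exact ⟨a, ha, t, ht, by rwa [← cancel_epi e.hom, comp_zero, ← Category.assoc]⟩

instance (m : ℤ) [D.IsClosedUnderIsomorphisms] : (w.lower D m).IsClosedUnderIsomorphisms where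
  of_iso e hX := ⟨D.prop_of_iso e hX.1, (w.le m).prop_of_iso e hX.2.1,
    (w.kills D m).prop_of_iso e hX.2.2⟩

instance (m : ℤ) [D.IsClosedUnderIsomorphisms] : (w.upper D m).IsClosedUnderIsomorphisms :=
  inferInstanceAs (D ⊓ w.ge m).IsClosedUnderIsomorphisms

/-- The connecting map goes from weights `≤ m` to weights `≥ m + 1`, so it vanishes and the
extension splits; the summands can then be swapped. -/
lemma extensionProduct_upper_lower_le (m : ℤ) :
    (w.upper D m).extensionProduct (w.lower D m) ≤
      (w.lower D m).extensionProduct (w.upper D m) := by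
  rintro X ⟨P, N, f, g, h, hT, hP, hN⟩
  obtain ⟨e, -, -⟩ := exists_iso_binaryBiproduct_of_distTriang _ hT
    (w.hom_eq_zero hN.2.1 ((w.ge_shift_iff P m 1 (m + 1) rfl).2 hP.2) (by lia) h)
  exact ObjectProperty.prop_of_iso _ (e ≪≫ biprod.braiding _ _).symm
    ⟨_, _, _, _, _, binaryBiproductTriangle_distinguished N P, hN, hP⟩

variable [D.IsTriangulated]

lemma kills_of_hom_eq_zero {m : ℤ} {X : C}
    (h : ∀ (b : C) (_ : w.heart b) (φ : X ⟶ b⟦m⟧), φ = 0) : w.kills D m X :=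
  fun b hb φ => ⟨b, hb, 𝟙 b, D.trW_of_isIso _, by simp [h b hb φ]⟩

variable [D.IsClosedUnderIsomorphisms]

instance (m : ℤ) : (w.upper D m).IsTriangulatedClosed₂ :=
  inferInstanceAs (D ⊓ w.ge m).IsTriangulatedClosed₂

instance (m : ℤ) : (w.upper D m).ContainsZero where
  exists_zero := ⟨_, isZero_zero C, D.prop_zero, w.ge_of_isZero (isZero_zero C)⟩

instance (m : ℤ) : (w.lower D m).ContainsZero where
  exists_zero := ⟨_, isZero_zero C, D.prop_zero, w.le_of_isZero (isZero_zero C),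
    w.kills_of_hom_eq_zero D (fun _ _ _ => (isZero_zero C).eq_of_src _ _)⟩

variable [IsTriangulated C]

instance (m : ℤ) : (w.kills D m).IsTriangulatedClosed₂ := .mk' (fun T hT h₁ h₃ b hb φ => by
  obtain ⟨a₁, ha₁, t₁, ht₁, hφ₁⟩ := h₁ b hb (T.mor₁ ≫ φ)
  obtain ⟨ψ, hψ⟩ := Triangle.yoneda_exact₂ _ hT (φ ≫ t₁⟦m⟧') (by simpa using hφ₁)
  obtain ⟨a₂, ha₂, t₂, ht₂, hφ₂⟩ := h₃ a₁ ha₁ ψ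
  exact ⟨a₂, ha₂, t₁ ≫ t₂, D.trW.comp_mem _ _ ht₁ ht₂, by
    rw [Functor.map_comp, reassoc_of% hψ, hφ₂, comp_zero]⟩)

instance (m : ℤ) : (w.lower D m).IsTriangulatedClosed₂ := .mk' (fun T hT h₁ h₃ =>
  ⟨D.ext_of_isTriangulatedClosed₂ T hT h₁.1 h₃.1,
    (w.le m).ext_of_isTriangulatedClosed₂ T hT h₁.2.1 h₃.2.1,
    (w.kills D m).ext_of_isTriangulatedClosed₂ T hT h₁.2.2 h₃.2.2⟩)

instance (m : ℤ) :
    ((w.lower D m).extensionProduct (w.upper D m)).IsTriangulatedClosed₂ :=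
  .mk' (fun T hT h₁ h₃ => by
    have h : ((w.lower D m).extensionProduct (w.upper D m)).extensionProduct
      ((w.lower D m).extensionProduct (w.upper D m)) T.obj₂ := ⟨_, _, _, _, _, hT, h₁, h₃⟩
    -- Reassociate to swap the two middle factors upper * lower, then merge the equal neighbours.
    rw [ObjectProperty.extensionProduct_assoc,
      ← ObjectProperty.extensionProduct_assoc (w.upper D m)] at h
    replace h := ObjectProperty.monotone_extensionProduct_right _
      (ObjectProperty.monotone_extensionProduct_left _
        (w.extensionProduct_upper_lower_le D m)) _ h
    rw [ObjectProperty.extensionProduct_assoc, ← ObjectProperty.extensionProduct_assoc] at h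
    exact ObjectProperty.monotone_extensionProduct_left _
      (ObjectProperty.extensionProduct_le_of_isTriangulatedClosed₂ le_rfl le_rfl) _
      (ObjectProperty.monotone_extensionProduct_right _
      (ObjectProperty.extensionProduct_le_of_isTriangulatedClosed₂ le_rfl le_rfl) _ h))

/-- The objects all of whose shifts can be truncated within `D` in all weights. -/
def truncatable : ObjectProperty C := fun X =>
  ∀ m n : ℤ, (w.lower D m).extensionProduct (w.upper D m) (X⟦n⟧)

instance : (w.truncatable D).IsClosedUnderIsomorphisms where
  of_iso e hX m n := ObjectProperty.prop_of_iso _ ((shiftFunctor C n).mapIso e) (hX m n)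

instance : (w.truncatable D).IsTriangulated where
  exists_zero := ⟨_, isZero_zero C, fun m n =>
    ObjectProperty.le_extensionProduct_left _ _
      ((w.lower D m).prop_of_isZero ((shiftFunctor C n).map_isZero (isZero_zero C)))⟩
  isStableUnderShiftBy k := ⟨fun X hX m n =>
    ObjectProperty.prop_of_iso _ ((shiftFunctorAdd' C k n (k + n) rfl).app X) (hX m (k + n))⟩
  toIsTriangulatedClosed₂ := .mk' (fun T hT h₁ h₃ m n =>
    ObjectProperty.ext_of_isTriangulatedClosed₂ _ _ (Triangle.shift_distinguished T hT n)
      (h₁ m n) (h₃ m n))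

end Truncation

/-! ### Cones of elements of `S` and the Ore condition -/

section Ore

variable {C : Type u₁} [Category.{v₁} C] [HasZeroObject C] [HasShift C ℤ] [Preadditive C]
  [∀ n : ℤ, (shiftFunctor C n).Additive] [Pretriangulated C] {w : WeightStructure C}
  {S : MorphismProperty w.Heart} {D : ObjectProperty C}

lemma ge_zero_of_mem_cones {Z : C} (hZ : w.cones S Z) : w.ge 0 Z := by
  obtain ⟨X, Y, s, g, h, -, hT⟩ := hZ
  exact (w.ge 0).ext_of_isTriangulatedClosed₂ _ (rot_of_distTriang _ hT)
    ((w.ge_zero_iff _).2 Y.property.2)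
    (w.ge_antitone (show (0 : ℤ) ≤ 1 by lia) _
      ((w.ge_shift_iff _ 0 1 1 rfl).2 ((w.ge_zero_iff _).2 X.property.2)))

lemma le_one_of_mem_cones {Z : C} (hZ : w.cones S Z) : w.le 1 Z := by
  obtain ⟨X, Y, s, g, h, -, hT⟩ := hZ
  exact (w.le 1).ext_of_isTriangulatedClosed₂ _ (rot_of_distTriang _ hT)
    (w.le_monotone (show (0 : ℤ) ≤ 1 by lia) _ ((w.le_zero_iff _).2 Y.property.1))
    ((w.le_shift_iff _ 0 1 1 rfl).2 ((w.le_zero_iff _).2 X.property.1))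

lemma ge_shift_of_nonneg {X : C} (hX : w.nonneg X) (n : ℤ) : w.ge n (X⟦n⟧) :=
  (w.ge_shift_iff _ 0 n n (zero_add n)).2 ((w.ge_zero_iff _).2 hX)

/-- The left Ore condition makes morphisms from cones of elements of `S` to shifted objects of
the heart vanish after composing with an element of `S`. -/
lemma exists_comp_shift_eq_zero (hS : LeftOre S) {Z b : C} (hZ : w.cones S Z) (hb : w.heart b)
    (φ : Z ⟶ b⟦(1 : ℤ)⟧) :
    ∃ (a : w.Heart) (t : (⟨b, hb⟩ : w.Heart) ⟶ a), S t ∧ φ ≫ t.hom⟦(1 : ℤ)⟧' = 0 := by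
  obtain ⟨X, Y, s, g, h, hs, hT⟩ := hZ
  -- By orthogonality `φ` vanishes on `Y`, so it comes from a morphism `X ⟶ b` of the heart, which
  -- forms a span with `s`.
  obtain ⟨ψ, rfl⟩ := exists_desc₃ hT φ
    (w.hom_eq_zero ((w.le_zero_iff _).2 Y.property.1) (w.ge_shift_of_nonneg hb.2 1)
      (by lia) _)
  obtain ⟨f, rfl⟩ := (shiftFunctor C (1 : ℤ)).map_surjective ψ
  obtain ⟨a, t, u, ht, hcomm⟩ := hS s (b := ⟨b, hb⟩) (ObjectProperty.homMk f) hs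
  refine ⟨a, t, ht, ?_⟩
  have hcomm' : f ≫ t.hom = s.hom ≫ u.hom := congr_arg (fun k => k.hom) hcomm
  have hz := comp_eq_zero₃₁ hT
  rw [Category.assoc, ← Functor.map_comp, hcomm', Functor.map_comp, reassoc_of% hz, zero_comp]

lemma trW_hom_of_mem (hD : w.cones S ≤ D) {X Y : w.Heart} {s : X ⟶ Y} (hs : S s) :
    D.trW s.hom := by
  obtain ⟨Z, g, h, hT⟩ := distinguished_cocone_triangle s.hom
  exact ⟨Z, g, h, hT, hD _ ⟨X, Y, s, g, h, hs, hT⟩⟩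

variable [D.IsTriangulated]

lemma kills_shift_of_mem_cones (hS : LeftOre S) (hD : w.cones S ≤ D) {Z : C}
    (hZ : w.cones S Z) {m n : ℤ} (hmn : n < m) : w.kills D m (Z⟦n⟧) := by
  -- The weights of `Z⟦n⟧` lie in `[n, n + 1]`: orthogonality settles everything but `m = n + 1`,
  -- where the Ore condition enters.
  rcases (show n + 1 < m ∨ 1 + n = m by lia) with h | h
  · exact w.kills_of_hom_eq_zero D (fun b hb φ => w.hom_eq_zero
      ((w.le_shift_iff _ 1 n (n + 1) (by ring)).2 (le_one_of_mem_cones hZ))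
      (w.ge_shift_of_nonneg hb.2 m) h φ)
  · intro b hb φ
    let e := shiftFunctorAdd' C 1 n m h
    obtain ⟨ψ, hψ⟩ := (shiftFunctor C n).map_surjective (φ ≫ e.hom.app b)
    obtain ⟨a, t, ht, h₀⟩ := exists_comp_shift_eq_zero hS hZ hb ψ
    refine ⟨a.obj, a.property, t.hom, trW_hom_of_mem hD ht, ?_⟩
    rw [← cancel_mono (e.hom.app a.obj), Category.assoc, e.hom.naturality, zero_comp,
      ← Category.assoc, ← hψ, Functor.comp_map, ← Functor.map_comp, h₀, Functor.map_zero]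

variable [D.IsClosedUnderIsomorphisms]

lemma cones_le_truncatable (hS : LeftOre S) (hD : w.cones S ≤ D) :
    w.cones S ≤ w.truncatable D := by
  intro Z hZ m n
  have hZn : D (Z⟦n⟧) := D.le_shift n _ (hD _ hZ)
  rcases lt_or_ge n m with h | h
  · exact ObjectProperty.le_extensionProduct_left _ _
      ⟨hZn, w.le_monotone (show n + 1 ≤ m by lia) _
        ((w.le_shift_iff _ 1 n (n + 1) (by ring)).2 (le_one_of_mem_cones hZ)),
        kills_shift_of_mem_cones hS hD hZ h⟩
  · exact ObjectProperty.le_extensionProduct_right _ _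
      ⟨hZn, w.ge_antitone h _ ((w.ge_shift_iff _ 0 n n (by ring)).2 (ge_zero_of_mem_cones hZ))⟩

end Ore

/-! ### Modifying objects by `D` to raise their weights -/

variable {C : Type u₁} [Category.{v₁} C] [HasZeroObject C] [HasShift C ℤ] [Preadditive C]
  [∀ n : ℤ, (shiftFunctor C n).Additive] [Pretriangulated C] {w : WeightStructure C}
  {D : ObjectProperty C}

lemma exists_truncation [D.IsClosedUnderIsomorphisms] (hD : D ≤ w.truncatable D) {X : C}
    (hX : D X) (m : ℤ) : (w.lower D m).extensionProduct (w.upper D m) X :=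
  ObjectProperty.prop_of_iso _ ((shiftFunctorZero C ℤ).app X) (hD X hX m 0)

/-- If `Y` has weights `≥ n + 1`, then any morphism in `D.trW` with source `Y` can be prolonged
to such a morphism with target of weights `≥ n + 1`. -/
lemma exists_ge_of_trW [IsTriangulated C] [D.IsTriangulated] [D.IsClosedUnderIsomorphisms]
    (hD : D ≤ w.truncatable D) {n : ℤ} {Y Z : C} (hY : w.ge (n + 1) Y) {s : Y ⟶ Z}
    (hs : D.trW s) : ∃ (Z' : C) (q : Z ⟶ Z'), D.trW q ∧ w.ge (n + 1) Z' := by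
  obtain ⟨d, g, h, hT, hd⟩ := hs
  obtain ⟨N, P, i, p, r, hd', hN, hP⟩ := exists_truncation hD hd (n + 1)
  -- The lower part `N` of the cone of `s` lifts to `Z`; dividing it out leaves `Z'` as an extension
  -- of `P` by `Y`.
  obtain ⟨j, hj⟩ := exists_lift₃ hT i
    (w.hom_eq_zero hN.2.1 ((w.ge_shift_iff Y (n + 1) 1 (n + 2) (by ring)).2 hY) (by lia) _)
  obtain ⟨Z', q, q', hq⟩ := distinguished_cocone_triangle j
  refine ⟨Z', q, ⟨_, _, _, rot_of_distTriang _ hq, D.le_shift 1 _ hN.1⟩, ?_⟩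
  have o := Triangulated.someOctahedron hj.symm hq (rot_of_distTriang _ hT) hd'
  have ho := inv_rot_of_distTriang _ o.mem
  refine (w.ge (n + 1)).ext_of_isTriangulatedClosed₂ _ ho ?_ hP.2
  exact (w.ge (n + 1)).prop_of_iso (shiftShiftNeg Y (1 : ℤ)).symm hY

lemma ge_of_distinguished {n : ℤ} {X Y Z : C} {f : X ⟶ Y} {g : Y ⟶ Z} {h : Z ⟶ X⟦(1 : ℤ)⟧}
    (hT : Triangle.mk f g h ∈ distTriang C) (hX : w.ge n X) (hZ : w.ge n Z) : w.ge n Y :=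
  (w.ge n).ext_of_isTriangulatedClosed₂ _ hT hX hZ

lemma ge_fst_of_distinguished {n : ℤ} {X Y Z : C} {f : X ⟶ Y} {g : Y ⟶ Z}
    {h : Z ⟶ X⟦(1 : ℤ)⟧} (hT : Triangle.mk f g h ∈ distTriang C) (hY : w.ge n Y)
    (hZ : w.ge (n + 1) Z) : w.ge n X :=
  (w.ge n).ext_of_isTriangulatedClosed₂ _ (inv_rot_of_distTriang _ hT)
    ((w.ge_shift_iff _ (n + 1) (-1) n (by ring)).2 hZ) hY

lemma exists_trW_of_kills [D.IsTriangulated] {m : ℤ} {N A : C} (hN : w.kills D m N) (hA : w.le m A)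
    (hA' : w.ge m A) (α : N ⟶ A) :
    ∃ (B : C) (τ : A ⟶ B), w.le m B ∧ w.ge m B ∧ D.trW τ ∧ α ≫ τ = 0 := by
  let e : A ≅ A⟦-m⟧⟦m⟧ := ((shiftFunctorCompIsoId C (-m) m (by simp)).app A).symm
  obtain ⟨a, ha, t, ht, h⟩ := hN (A⟦-m⟧) ⟨hA, hA'⟩ (α ≫ e.hom)
  exact ⟨a⟦m⟧, e.hom ≫ t⟦m⟧', (w.le_shift_iff _ 0 m m (by simp)).2 ((w.le_zero_iff _).2 ha.1),
    w.ge_shift_of_nonneg ha.2 m,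
    MorphismProperty.RespectsIso.precomp _ e.hom _ (ObjectProperty.trW.shift ht m), by
      rwa [← Category.assoc]⟩

/-- An object of weights `≥ m` such that all morphisms to it from objects of weights `≤ m`
factor through `D` can be modified by an object of `D` of weights `≤ m + 1` to become of
weights `≥ m + 1`. -/
lemma exists_triangle_of_factors [IsTriangulated C] [D.IsTriangulated]
    [D.IsClosedUnderIsomorphisms] (hD : D ≤ w.truncatable D) {m : ℤ} {X : C} (hX : w.ge m X)
    (hfac : ∀ (Z : C) (_ : w.le m Z) (f : Z ⟶ X),
      ∃ (d : C) (_ : D d) (i : Z ⟶ d) (p : d ⟶ X), i ≫ p = f) :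
    ∃ (T X' : C) (f : T ⟶ X) (g : X ⟶ X') (h : X' ⟶ T⟦(1 : ℤ)⟧),
      Triangle.mk f g h ∈ distTriang C ∧ D T ∧ w.le (m + 1) T ∧ w.ge (m + 1) X' := by
  obtain ⟨A, B, a, b, c, hABX, hA, hB⟩ := w.exists_decomposition m X
  -- `A` is pure of weight `m`, so the property `kills` applies to maps into it.
  have hA' : w.ge m A := ge_fst_of_distinguished hABX hX hB
  obtain ⟨d, hd, i, p, rfl⟩ := hfac A hA a
  obtain ⟨N, P, j, q, r, hNP, hN, hP⟩ := exists_truncation hD hd m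
  obtain ⟨α, hα⟩ := exists_lift hABX (j ≫ p) (w.hom_eq_zero hN.2.1 hB (by lia) _)
  -- Killing `α` makes it factor through the fibre `Q` of `τ`; after dividing out `Q`, the map `N ⟶
  -- d₁ ⟶ X₁` becomes zero.
  obtain ⟨A₁, τ, hA₁, hA₁', hτ, hατ⟩ := exists_trW_of_kills hN.2.2 hA hA' α
  obtain ⟨Q, ι, ρ, hQ⟩ := distinguished_cocone_triangle₁ τ
  have hDQ : D Q := (D.trW_iff_of_distinguished' _ hQ).1 hτ
  have hQle : w.le m Q := (w.le m).ext_of_isTriangulatedClosed₂ _ (inv_rot_of_distTriang _ hQ)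
    (w.le_monotone (show m - 1 ≤ m by lia) _ ((w.le_shift_iff _ m (-1) _ (by ring)).2 hA₁)) hA
  have hAshift : w.ge (m + 1) (A⟦(1 : ℤ)⟧) := (w.ge_shift_iff _ m 1 _ rfl).2 hA'
  have hQge : w.ge m (Q⟦(1 : ℤ)⟧) := ge_of_distinguished
    (rot_of_distTriang _ (rot_of_distTriang _ hQ)) hA₁' (w.ge_antitone (by lia) _ hAshift)
  obtain ⟨β, rfl⟩ := exists_lift hQ α hατ
  obtain ⟨d₁, u, u', hd₁⟩ := distinguished_cocone_triangle (ι ≫ i)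
  obtain ⟨X₁, v, v', hX₁⟩ := distinguished_cocone_triangle (ι ≫ i ≫ p)
  obtain ⟨γ, hγ₁, hγ₂⟩ : ∃ γ : d₁ ⟶ X₁, u ≫ γ = p ≫ v ∧ u' ≫ (𝟙 Q)⟦1⟧' = γ ≫ v' :=
    complete_distinguished_triangle_morphism _ _ hd₁ hX₁ (𝟙 Q) p
      ((Category.assoc _ _ _).trans (Category.id_comp _).symm)
  obtain ⟨d₂, κ, κ', hd₂⟩ := distinguished_cocone_triangle (j ≫ u)
  have hPQ := (Triangulated.someOctahedron rfl hNP (rot_of_distTriang _ hd₁) hd₂).mem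
  have hDQ' : D (Q⟦(1 : ℤ)⟧) := D.le_shift 1 _ hDQ
  have hd₂ge : w.ge m d₂ := ge_of_distinguished hPQ hP.2 hQge
  have hDd₂ : D d₂ := D.ext_of_isTriangulatedClosed₂ _ hPQ hP.1 hDQ'
  -- So `γ` factors through `d₂`, which, unlike `d₁`, is known to have weights `≥ m`.
  obtain ⟨γ', rfl⟩ := exists_desc hd₂ γ (by
    rw [Category.assoc, hγ₁, reassoc_of% hα]
    simpa using β ≫= comp_eq_zero₁₂ hX₁)
  -- Only the part `y` of weights `≤ m + 1` is divided out of `X₁`, which keeps the weights of `T`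
  -- bounded by `m + 1`.
  obtain ⟨y, z, σ, π, ω, hyz, hy, hz⟩ := exists_truncation hD hDd₂ (m + 1)
  have hyge : w.ge m y := ge_fst_of_distinguished hyz hd₂ge hz.2
  obtain ⟨X', v₂, v₂', hX'⟩ := distinguished_cocone_triangle (σ ≫ γ')
  obtain ⟨T, f, h, hT⟩ := distinguished_cocone_triangle₁ (v ≫ v₂)
  have hQTy := (Triangulated.someOctahedron' rfl hX₁ hX' hT).mem
  refine ⟨T, X', f, v ≫ v₂, h, hT, D.ext_of_isTriangulatedClosed₂ _ hQTy hDQ hy.1,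
    (w.le (m + 1)).ext_of_isTriangulatedClosed₂ _ hQTy (w.le_monotone (by lia) _ hQle) hy.2.1,
    w.ge_of_forall_hom_eq_zero (fun Z hZ x => ?_)⟩
  -- A map from weights `≤ m` lifts to `X₁`. Correcting by a map through `d₁` lifts it to `X`, then
  -- to `A`, and `a` factors through `d`; so it passes through `d₂`, hence through `y`, and dies in
  -- `X'`.
  obtain ⟨x₁, rfl⟩ := exists_lift₃ hX' x
    (w.hom_eq_zero hZ ((w.ge_shift_iff _ m 1 _ rfl).2 hyge) (by lia) _)
  obtain ⟨x₂, hx₂⟩ : ∃ x₂ : Z ⟶ d₁, x₂ ≫ u' = x₁ ≫ v' := by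
    have h₀ : (x₁ ≫ v') ≫ (ι ≫ i)⟦1⟧' = 0 := by
      rw [Functor.map_comp, ← Category.assoc,
        w.hom_eq_zero hZ hAshift (by lia) ((x₁ ≫ v') ≫ ι⟦1⟧'), zero_comp]
    obtain ⟨x₂, hx₂⟩ := Triangle.coyoneda_exact₁ _ hd₁ (x₁ ≫ v') h₀
    exact ⟨x₂, hx₂.symm⟩
  obtain ⟨x₃, hx₃⟩ := exists_lift₃ hX₁ (x₁ - x₂ ≫ κ ≫ γ') (by
    rw [CategoryTheory.Functor.map_id, Category.comp_id] at hγ₂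
    rw [Preadditive.sub_comp, Category.assoc, ← hγ₂, hx₂, sub_self])
  obtain ⟨x₄, rfl⟩ := exists_lift hABX x₃ (w.hom_eq_zero hZ hB (by lia) _)
  have hx₁ : x₁ = (x₂ + x₄ ≫ i ≫ u) ≫ κ ≫ γ' := by
    rw [← sub_add_cancel x₁ (x₂ ≫ κ ≫ γ'), hx₃, Preadditive.add_comp, add_comm]
    simp only [Category.assoc, hγ₁]
  obtain ⟨x₅, hx₅⟩ := exists_lift hyz ((x₂ + x₄ ≫ i ≫ u) ≫ κ)
    (w.hom_eq_zero hZ hz.2 (by lia) _)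
  rw [hx₁, ← Category.assoc _ κ, hx₅, Category.assoc, Category.assoc, ← Category.assoc σ,
    comp_eq_zero₁₂ hX', comp_zero]

/-- If `X` has weights `≥ n - k` and all morphisms from objects of weights `< n` to objects
`D.trW`-isomorphic to `X` factor through `D`, then an object of `D` of weights `≤ n` modifies `X`
to an object of weights `≥ n`. -/
lemma exists_triangle_of_forall_factors [IsTriangulated C] [D.IsTriangulated]
    [D.IsClosedUnderIsomorphisms] (hD : D ≤ w.truncatable D) (n : ℤ) (k : ℕ) {X : C}
    (hX : w.ge (n - k) X)
    (hfac : ∀ (Z X₁ : C) (g : X ⟶ X₁) (_ : D.trW g) (m : ℤ) (_ : m < n) (_ : w.le m Z)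
      (f : Z ⟶ X₁), ∃ (d : C) (_ : D d) (i : Z ⟶ d) (p : d ⟶ X₁), i ≫ p = f) :
    ∃ (T X' : C) (f : T ⟶ X) (g : X ⟶ X') (h : X' ⟶ T⟦(1 : ℤ)⟧),
      Triangle.mk f g h ∈ distTriang C ∧ D T ∧ w.le n T ∧ w.ge n X' := by
  induction k generalizing X with
  | zero =>
    exact ⟨_, X, 0, 𝟙 X, 0, contractible_distinguished₁ X, D.prop_zero,
      w.le_of_isZero (isZero_zero C), by simpa using hX⟩
  | succ k ih =>
    obtain ⟨T₁, X₁, f₁, g₁, h₁, hT₁, hDT₁, hT₁le, hX₁⟩ := exists_triangle_of_factors hD hX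
      (fun Z hZ f => hfac Z X (𝟙 X) (D.trW_of_isIso _) _ (by push_cast; lia) hZ f)
    have hg₁ : D.trW g₁ := (D.trW_iff_of_distinguished' _ hT₁).2 hDT₁
    obtain ⟨T₂, X₂, f₂, g₂, h₂, hT₂, hDT₂, hT₂le, hX₂⟩ := ih (X := X₁)
      (by rwa [show n - (k : ℤ) = n - (k + 1 : ℕ) + 1 by push_cast; ring])
      -- Stating `hfac` for all targets reached from `X` by `D.trW` lets it pass to the modified
      -- object.
      (fun Z X₁ g hg m hm hZ f => hfac Z X₁ (g₁ ≫ g) (D.trW.comp_mem _ _ hg₁ hg) m hm hZ f)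
    obtain ⟨T, f, h, hT⟩ := distinguished_cocone_triangle₁ (g₁ ≫ g₂)
    have ho := (Triangulated.someOctahedron' rfl hT₁ hT₂ hT).mem
    exact ⟨T, X₂, f, _, h, hT, D.ext_of_isTriangulatedClosed₂ _ ho hDT₁ hDT₂,
      (w.le n).ext_of_isTriangulatedClosed₂ _ ho
        (w.le_monotone (by push_cast; lia) _ hT₁le) hT₂le, hX₂⟩

end WeightStructure

end WeightLifting

namespace WeightLifting

/-! ### Descent to the localization and lifting of weights -/

section

variable {C : Type u₁} [Category.{v₁} C] [HasZeroObject C] [HasShift C ℤ] [Preadditive C]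
  [∀ n : ℤ, (shiftFunctor C n).Additive] [Pretriangulated C] [IsTriangulated C]

lemma triangulatedClosure_le_truncatable {w : WeightStructure C}
    {S : MorphismProperty w.Heart} (hS : LeftOre S) :
    triangulatedClosure (w.cones S) ≤ w.truncatable (triangulatedClosure (w.cones S)) :=
  fun _ hX => hX _ inferInstance inferInstance
    (WeightStructure.cones_le_truncatable hS (le_triangulatedClosure _))

end

variable {C : Type u₁} [Category.{v₁} C] [HasZeroObject C] [HasShift C ℤ] [Preadditive C]
  [∀ n : ℤ, (shiftFunctor C n).Additive] [Pretriangulated C] {w : WeightStructure C}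
  {E : Type u₂} [Category.{v₂} E] [HasZeroObject E] [HasShift E ℤ] [Preadditive E]
  [∀ n : ℤ, (shiftFunctor E n).Additive] [Pretriangulated E]
  {L : C ⥤ E} [L.CommShift ℤ]

namespace WeightExact

variable {w' : WeightStructure E}

lemma le (hL : WeightExact L w w') {n : ℤ} {X : C} (hX : w.le n X) : w'.le n (L.obj X) :=
  w'.nonpos.prop_of_iso ((L.commShiftIso (-n)).app X) (hL.nonpos _ hX)

lemma ge (hL : WeightExact L w w') {n : ℤ} {X : C} (hX : w.ge n X) : w'.ge n (L.obj X) :=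
  w'.nonneg.prop_of_iso ((L.commShiftIso (-n)).app X) (hL.nonneg _ hX)

end WeightExact

variable [L.IsTriangulated] {D : ObjectProperty C} [D.IsTriangulated] [L.IsLocalization D.trW]

lemma isZero_obj_of_prop {T : C} (hT : D T) : IsZero (L.obj T) := by
  have h : D.trW (0 : T ⟶ _) := ⟨_, _, _, contractible_distinguished₂ T, D.le_shift 1 _ hT⟩
  have := Localization.inverts L D.trW _ h
  exact (L.map_isZero (isZero_zero C)).of_iso (@asIso _ _ _ _ _ this)

variable [IsTriangulated C]

/-- By calculus of fractions `f` is killed by some `s` in `D.trW`, so it factors through the fibre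
of `s`. -/
lemma exists_factors_of_map_eq_zero [D.IsClosedUnderIsomorphisms] {X Y : C} {f : X ⟶ Y}
    (hf : L.map f = 0) : ∃ (d : C) (_ : D d) (i : X ⟶ d) (p : d ⟶ Y), i ≫ p = f := by
  rw [← L.map_zero, MorphismProperty.map_eq_iff_postcomp L D.trW] at hf
  obtain ⟨Z, s, hs, hfs⟩ := hf
  obtain ⟨d, p, h, hT⟩ := distinguished_cocone_triangle₁ s
  obtain ⟨i, hi⟩ := exists_lift hT f (by rw [hfs, zero_comp])
  exact ⟨d, (D.trW_iff_of_distinguished' _ hT).1 hs, i, p, hi.symm⟩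

/-- Represent `f` by a left fraction and prolong its denominator until the target has weights `≥ m +
1`; the numerator then vanishes by orthogonality in `C`. -/
lemma hom_eq_zero_of_isLocalization [D.IsClosedUnderIsomorphisms] (hD : D ≤ w.truncatable D)
    {m n : ℤ} {X Y : C} (hX : w.le m X) (hY : w.ge n Y) (hmn : m < n)
    (f : L.obj X ⟶ L.obj Y) : f = 0 := by
  obtain ⟨φ, rfl⟩ := Localization.exists_leftFraction L D.trW f
  obtain ⟨Z, q, hq, hZ⟩ := WeightStructure.exists_ge_of_trW hD (n := m) (Y := Y)
    (w.ge_antitone (by lia) _ hY) φ.hs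
  have := Localization.inverts L D.trW q hq
  have h₀ : L.map φ.f = 0 := by
    rw [← cancel_mono (L.map q), ← L.map_comp, w.hom_eq_zero hX hZ (by lia) (φ.f ≫ q),
      L.map_zero, zero_comp]
  rw [MorphismProperty.LeftFraction.map, h₀, zero_comp]

variable (L) in
/-- The weight structure on a localization by a triangulated subcategory `D` whose objects can be
truncated within `D`: its classes are the retract closures of the images of those of `w`. -/
def localizedWeightStructure [D.IsClosedUnderIsomorphisms] (hD : D ≤ w.truncatable D) :
    WeightStructure E where
  nonpos := (w.nonpos.map L).retractClosure
  nonneg := (w.nonneg.map L).retractClosure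
  nonpos_retracts := inferInstance
  nonneg_retracts := inferInstance
  nonpos_shift := by
    rintro X ⟨Y, ⟨Z, hZ, ⟨e⟩⟩, ⟨r⟩⟩
    exact ⟨_, ⟨_, w.nonpos_shift _ hZ, ⟨(L.commShiftIso (-1 : ℤ)).app Z ≪≫
      (shiftFunctor E (-1 : ℤ)).mapIso e⟩⟩, ⟨r.map (shiftFunctor E (-1 : ℤ))⟩⟩
  nonneg_shift := by
    rintro X ⟨Y, ⟨Z, hZ, ⟨e⟩⟩, ⟨r⟩⟩
    exact ⟨_, ⟨_, w.nonneg_shift _ hZ, ⟨(L.commShiftIso (1 : ℤ)).app Z ≪≫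
      (shiftFunctor E (1 : ℤ)).mapIso e⟩⟩, ⟨r.map (shiftFunctor E (1 : ℤ))⟩⟩
  orthogonality := by
    rintro X Y ⟨X₁, ⟨X₂, hX₂, ⟨e⟩⟩, ⟨r⟩⟩ ⟨Y₁, ⟨Y₂, hY₂, ⟨e'⟩⟩, ⟨r'⟩⟩ f
    let ε := (L.commShiftIso (1 : ℤ)).app Y₂ ≪≫ (shiftFunctor E (1 : ℤ)).mapIso e'
    have h := hom_eq_zero_of_isLocalization hD ((w.le_zero_iff _).2 hX₂)
      (w.ge_shift_of_nonneg hY₂ 1) (by lia) (e.hom ≫ r.r ≫ f ≫ r'.i⟦1⟧' ≫ ε.inv)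
    have h' : r.i ≫ e.inv ≫ (e.hom ≫ r.r ≫ f ≫ r'.i⟦1⟧' ≫ ε.inv) ≫ ε.hom ≫ r'.r⟦1⟧' = f := by
      simp [← Functor.map_comp]
    rw [← h', h, zero_comp, comp_zero, comp_zero]
  decomposition := by
    intro M
    have := Localization.essSurj L D.trW
    obtain ⟨A, B, f, g, h, hA, hB, hT⟩ := w.decomposition (L.objPreimage M)
    have ι := L.objObjPreimageIso M
    let ε := (L.commShiftIso (1 : ℤ)).app B
    refine ⟨L.obj A, L.obj B, L.map f ≫ ι.hom, ι.inv ≫ L.map g ≫ ε.hom,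
      ε.inv ≫ L.map h ≫ (L.commShiftIso (1 : ℤ)).hom.app A,
      ObjectProperty.le_retractClosure _ _ ⟨A, hA, ⟨Iso.refl _⟩⟩,
      ObjectProperty.le_retractClosure _ _ ⟨B, hB, ⟨Iso.refl _⟩⟩, ?_⟩
    refine isomorphic_distinguished _ (L.map_distinguished _ hT) _
      (Triangle.isoMk _ _ (Iso.refl _) ι.symm ε.symm ?_ ?_ ?_)
    · change (L.map f ≫ ι.hom) ≫ ι.inv = 𝟙 (L.obj A) ≫ L.map f
      simp
    · change (ι.inv ≫ L.map g ≫ ε.hom) ≫ ε.inv = ι.inv ≫ L.map g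
      simp
    · change (ε.inv ≫ L.map h ≫ (L.commShiftIso (1 : ℤ)).hom.app A) ≫ (𝟙 (L.obj A))⟦(1 : ℤ)⟧' =
        ε.inv ≫ L.map h ≫ (L.commShiftIso (1 : ℤ)).hom.app A
      simp

lemma weightExact_localizedWeightStructure [D.IsClosedUnderIsomorphisms]
    (hD : D ≤ w.truncatable D) : WeightExact L w (localizedWeightStructure L hD) where
  nonpos X hX := ObjectProperty.le_retractClosure _ _ ⟨X, hX, ⟨Iso.refl _⟩⟩
  nonneg X hX := ObjectProperty.le_retractClosure _ _ ⟨X, hX, ⟨Iso.refl _⟩⟩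

lemma WeightExact.localizedWeightStructure_eq [D.IsClosedUnderIsomorphisms]
    (hD : D ≤ w.truncatable D) {w' : WeightStructure E} (hL : WeightExact L w w') :
    localizedWeightStructure L hD = w' := by
  apply WeightStructure.eq_of_le
  · rintro X ⟨Y, ⟨Z, hZ, ⟨e⟩⟩, ⟨r⟩⟩
    exact w'.nonpos.prop_of_retract r (w'.nonpos.prop_of_iso e (hL.nonpos Z hZ))
  · rintro X ⟨Y, ⟨Z, hZ, ⟨e⟩⟩, ⟨r⟩⟩
    exact w'.nonneg.prop_of_retract r (w'.nonneg.prop_of_iso e (hL.nonneg Z hZ))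

lemma WeightExact.exists_triangle [D.IsClosedUnderIsomorphisms]
    (hD : D ≤ w.truncatable D) (hw : w.BoundedBelow) {w' : WeightStructure E}
    (hL : WeightExact L w w') {X : C} (hX : w'.nonneg (L.obj X)) :
    ∃ (T X' : C) (f : T ⟶ X) (g : X ⟶ X') (h : X' ⟶ T⟦(1 : ℤ)⟧),
      Triangle.mk f g h ∈ distTriang C ∧ D T ∧ w.nonpos T ∧ w.nonneg X' := by
  obtain ⟨n, hn⟩ := hw X
  obtain ⟨T, X', f, g, h, hT, hDT, hTle, hX'⟩ :=
    -- The number of unit steps from weight `n` up to `0`, or none when `n` is already nonnegative.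
    WeightStructure.exists_triangle_of_forall_factors hD 0 (-n).toNat
      (w.ge_antitone (by lia) _ hn) (fun Z X₁ g hg m hm hZ f => by
        have := Localization.inverts L D.trW g hg
        have hX₁ := w'.nonneg.prop_of_iso (asIso (L.map g)) hX
        exact exists_factors_of_map_eq_zero (L := L)
          (w'.hom_eq_zero (hL.le hZ) ((w'.ge_zero_iff _).2 hX₁) hm _))
  exact ⟨T, X', f, g, h, hT, hDT, (w.le_zero_iff _).1 hTle, (w.ge_zero_iff _).1 hX'⟩

end WeightLifting

theorem theorem3p2
    {C : Type u₁} [Category.{v₁} C] [HasZeroObject C] [HasShift C ℤ] [Preadditive C]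
    [∀ n : ℤ, (shiftFunctor C n).Additive] [Pretriangulated C] [IsTriangulated C]
    (w : WeightLifting.WeightStructure C) (hw : w.BoundedBelow)
    (S : MorphismProperty w.Heart) (hS : WeightLifting.LeftOre S)
    (D : ObjectProperty C) (hD : D = WeightLifting.triangulatedClosure (w.cones S))
    {E : Type u₂} [Category.{v₂} E] [HasZeroObject E] [HasShift E ℤ] [Preadditive E]
    [∀ n : ℤ, (shiftFunctor E n).Additive] [Pretriangulated E]
    (L : C ⥤ E) [L.CommShift ℤ] [L.IsTriangulated] [L.IsLocalization D.trW] :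
    (∃! w' : WeightLifting.WeightStructure E, WeightLifting.WeightExact L w w') ∧
    ∀ w' : WeightLifting.WeightStructure E, WeightLifting.WeightExact L w w' →
      WeightLifting.StrongLeftWeightLifting L w w' ∧
      ∀ X : C, w'.nonneg (L.obj X) →
        ∃ (T X' : C) (f : T ⟶ X) (g : X ⟶ X') (h : X' ⟶ T⟦(1 : ℤ)⟧),
          Triangle.mk f g h ∈ distTriang C ∧ D T ∧ w.nonpos T ∧ w.nonneg X' := by
  subst hD
  have hD := WeightLifting.triangulatedClosure_le_truncatable hS
  refine ⟨⟨_, WeightLifting.weightExact_localizedWeightStructure hD,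
    fun w' hL => (hL.localizedWeightStructure_eq hD).symm⟩, fun w' hL => ⟨fun X hX => ?_,
    fun X hX => hL.exists_triangle hD hw hX⟩⟩
  obtain ⟨T, X', f, g, h, hT, hDT, -, hX'⟩ := hL.exists_triangle hD hw hX
  exact ⟨T, X', f, g, h, hT, WeightLifting.isZero_obj_of_prop hDT, hX'⟩
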